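/- Let $G$ be a totally disconnected, metrizable, locally compact group with identity $e$, let $\operatorname{Aut}(G)$ be the group of topological automorphisms of $G$ (group automorphisms that are homeomorphisms), and let $\Gamma$ be a subgroup of $\operatorname{Aut}(G)$ that contains a polycyclic subgroup of finite index. Then the following conditions are equivalent: (i) $\Gamma$ is distal, that is, for every $x\in G$ with $x\neq e$, the identity $e$ is not in the closure of the orbit $\{\gamma(x) : \gamma\in\Gamma\}$; (ii) every $\gamma\in\Gamma$ is distal, that is, for every $\gamma\in\Gamma$ the cyclic subgroup $\langle\gamma\rangle$ of $\operatorname{Aut}(G)$ generated by $\gamma$ is distal in the sense of (i); (iii) $\Gamma$ is equicontinuous, that is, the neighbourhoods $V$ of $e$ with $\gamma(V)=V$ for all $\gamma\in\Gamma$ form a neighbourhood base at $e$. Here a group $P$ is polycyclic if it has a finite series $\{1\}=H_0\le H_1\le\dots\le H_n=P$ of subgroups such that, for each $i<n$, $H_i$ is normal in $H_{i+1}$ and $H_{i+1}/H_i$ is cyclic. -/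

import Mathlib

open Topology

/-- A group is polycyclic if it has a finite subnormal series
`1 = H 0 ⊴ H 1 ⊴ ⋯ ⊴ H n = P` all of whose factors `H (i + 1) / H i` are cyclic. -/
def IsPolycyclic (P : Type*) [Group P] : Prop :=
  ∃ (n : ℕ) (H : ℕ → Subgroup P), H 0 = ⊥ ∧ H n = ⊤ ∧
    ∀ i < n, H i ≤ H (i + 1) ∧
      ∃ _ : ((H i).subgroupOf (H (i + 1))).Normal,
        IsCyclic (H (i + 1) ⧸ (H i).subgroupOf (H (i + 1)))

section TopologicalAutomorphisms

variable {G : Type*} [Group G] [TopologicalSpace G]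

/-- The group of topological automorphisms of `G`, under composition. -/
instance ContinuousMulEquiv.instGroupAut : Group (G ≃ₜ* G) where
  mul γ δ := δ.trans γ
  one := ContinuousMulEquiv.refl G
  inv γ := γ.symm
  mul_assoc _ _ _ := rfl
  one_mul _ := rfl
  mul_one _ := rfl
  inv_mul_cancel γ := ContinuousMulEquiv.ext fun x => γ.symm_apply_apply x

theorem ContinuousMulEquiv.aut_mul_apply (γ δ : G ≃ₜ* G) (x : G) : (γ * δ) x = γ (δ x) := rfl

theorem ContinuousMulEquiv.aut_one_apply (x : G) : (1 : G ≃ₜ* G) x = x := rfl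

theorem ContinuousMulEquiv.aut_inv_apply (γ : G ≃ₜ* G) (x : G) : γ⁻¹ x = γ.symm x := rfl

/-- A group `Γ` of topological automorphisms of `G` is distal if, for every `x ≠ 1`,
the identity is not in the closure of the orbit of `x` under `Γ`. -/
def IsDistalGroup (Γ : Subgroup (G ≃ₜ* G)) : Prop :=
  ∀ x : G, x ≠ 1 → (1 : G) ∉ closure {y : G | ∃ γ ∈ Γ, γ x = y}

/-- A topological automorphism is distal if the subgroup it generates is distal. -/
def IsDistalAut (γ : G ≃ₜ* G) : Prop :=
  IsDistalGroup (Subgroup.zpowers γ)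

/-- A group `Γ` of topological automorphisms of `G` is equicontinuous (at the identity) if
the `Γ`-invariant neighbourhoods of the identity form a neighbourhood base there. -/
def IsEquicontinuousGroup (Γ : Subgroup (G ≃ₜ* G)) : Prop :=
  (𝓝 (1 : G)).HasBasis (fun V : Set G => V ∈ 𝓝 (1 : G) ∧ ∀ γ ∈ Γ, γ '' V = V) id

end TopologicalAutomorphisms

/-!
The crux is that pointwise distality implies equicontinuity. If `α` is distal, a point `x` whose
forward `α`-orbit stays in a compact set is recurrent: along an idempotent ultrafilter the orbits
of `x` and of its limit `y` both converge to `y`, so the orbit of `x⁻¹ * y` converges to `1` and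
`x = y`. Hence a point of a compact open set `U` that never leaves `U` under positive powers of `α`
never leaves it under negative ones, and by compactness finitely many powers suffice to detect
this. So the set of points whose whole `α`-orbit stays in `U` is again compact and open. Applying
this along generators of the factors of the polycyclic series, and then to finitely many coset
representatives, yields inside every compact open neighbourhood of `1` one that is invariant under
the whole group.
-/

open Filter Set
open scoped Pointwise

section Recurrence

attribute [local instance] Ultrafilter.add Ultrafilter.addSemigroup

theorem exists_add_idempotent_ultrafilter (M : Type*) [AddSemigroup M] [Nonempty M] :
    ∃ p : Ultrafilter M, p + p = p :=
  exists_idempotent_of_compact_t2_of_continuous_add_left Ultrafilter.continuous_add_left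

theorem tendsto_iterate_of_add_self_eq {X : Type*} [TopologicalSpace X] [RegularSpace X]
    {f : X → X} (hf : Continuous f) {p : Ultrafilter ℕ+} (hp : p + p = p) {x y : X}
    (hxy : Tendsto (fun n : ℕ+ => f^[n] x) p (𝓝 y)) :
    Tendsto (fun n : ℕ+ => f^[n] y) p (𝓝 y) := by
  refine (closed_nhds_basis y).tendsto_right_iff.2 fun C ⟨hC, hC_closed⟩ => ?_
  have h_double : ∀ᶠ m in p, ∀ᶠ n in p, f^[(m + n : ℕ+)] x ∈ C := by
    rw [← Ultrafilter.eventually_add p p fun k : ℕ+ => f^[k] x ∈ C, hp]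
    exact hxy hC
  filter_upwards [h_double] with m hm
  have h_shift : Tendsto (fun n : ℕ+ => f^[m] (f^[n] x)) p (𝓝 (f^[m] y)) :=
    ((hf.iterate m).tendsto y).comp hxy
  refine hC_closed.mem_of_tendsto h_shift ?_
  filter_upwards [hm] with n hn
  rwa [← Function.iterate_add_apply, ← PNat.add_coe]

/-- An element `g` of a monoid acting on `X` is recurrent on compacts if every point whose forward
`g`-orbit stays in a compact set is in the closure of its strictly forward orbit. The exponents are
positive, since `n = 0` would make the condition vacuous. -/
def IsRecurrentOnCompacts (X : Type*) [TopologicalSpace X] {M : Type*} [Monoid M] [MulAction M X]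
    (g : M) : Prop :=
  ∀ ⦃K : Set X⦄, IsCompact K → ∀ ⦃x : X⦄, (∀ n : ℕ, g ^ n • x ∈ K) →
    x ∈ closure (range fun n : ℕ+ => g ^ (n : ℕ) • x)

theorem isRecurrentOnCompacts_of_one_notMem_closure {G : Type*} [Group G] [TopologicalSpace G]
    [IsTopologicalGroup G] {M : Type*} [Monoid M] [MulDistribMulAction M G]
    [ContinuousConstSMul M G] {g : M}
    (hg : ∀ z : G, z ≠ 1 → (1 : G) ∉ closure (range fun n : ℕ+ => g ^ (n : ℕ) • z)) :
    IsRecurrentOnCompacts G g := by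
  intro K hK x hx
  obtain ⟨p, hp⟩ := exists_add_idempotent_ultrafilter ℕ+
  obtain ⟨y, -, hxy⟩ : ∃ y ∈ K, Tendsto (fun n : ℕ+ => g ^ (n : ℕ) • x) p (𝓝 y) :=
    hK.ultrafilter_le_nhds (p.map fun n : ℕ+ => g ^ (n : ℕ) • x)
      (tendsto_principal.2 (Eventually.of_forall fun n : ℕ+ => hx n))
  have hyy : Tendsto (fun n : ℕ+ => g ^ (n : ℕ) • y) p (𝓝 y) := by
    simp only [← smul_iterate_apply] at hxy ⊢
    exact tendsto_iterate_of_add_self_eq (continuous_const_smul g) hp hxy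
  have h_one : Tendsto (fun n : ℕ+ => g ^ (n : ℕ) • (x⁻¹ * y)) p (𝓝 1) := by
    simpa only [smul_mul', smul_inv', inv_mul_cancel] using hxy.inv.mul hyy
  have h_eq : x = y := by
    by_contra hne
    exact hg (x⁻¹ * y) (mt inv_mul_eq_one.1 hne)
      (mem_closure_of_tendsto h_one (Eventually.of_forall mem_range_self))
  rw [← h_eq] at hxy
  exact mem_closure_of_tendsto hxy (Eventually.of_forall mem_range_self)

end Recurrence

theorem exists_zpowers_mul_coe_eq {Γ : Type*} [Group Γ] {H K : Subgroup Γ} (hHK : H ≤ K)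
    [(H.subgroupOf K).Normal] [IsCyclic (K ⧸ H.subgroupOf K)] :
    ∃ g : Γ, (Subgroup.zpowers g : Set Γ) * (H : Set Γ) = K := by
  obtain ⟨q, hq⟩ := IsCyclic.exists_generator (α := K ⧸ H.subgroupOf K)
  obtain ⟨g, rfl⟩ := QuotientGroup.mk_surjective q
  refine ⟨g, Subset.antisymm ?_ fun h hh => ?_⟩
  · exact mul_subset_iff.2 fun _ ha _ hb =>
      mul_mem (Subgroup.zpowers_le.2 g.2 ha) (hHK hb)
  · obtain ⟨j, hj⟩ := hq (QuotientGroup.mk ⟨h, hh⟩)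
    have h_mem : (g ^ j)⁻¹ * ⟨h, hh⟩ ∈ H.subgroupOf K :=
      QuotientGroup.eq.1 ((QuotientGroup.mk_zpow _ g j).trans hj)
    exact ⟨_, ⟨j, rfl⟩, _, h_mem, mul_inv_cancel_left _ _⟩

theorem one_mem_image_pow {M : Type*} [Monoid M] (g : M) {N : Set ℕ} (hN : 0 ∈ N) :
    (1 : M) ∈ (g ^ ·) '' N :=
  ⟨0, hN, pow_zero g⟩

section InvariantCore

variable {Γ X : Type*} [Group Γ] [MulAction Γ X]

/-- The `S`-core of `U`: the points whose translates by elements of `S` all lie in `U`. When `S` is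
a subgroup, this is the largest `S`-invariant subset of `U`. -/
def invariantCore (S : Set Γ) (U : Set X) : Set X :=
  {x | ∀ g ∈ S, g • x ∈ U}

theorem invariantCore_eq_biInter (S : Set Γ) (U : Set X) :
    invariantCore S U = ⋂ g ∈ S, (g • ·) ⁻¹' U := by
  ext x
  simp only [invariantCore, mem_ofPred_eq, mem_iInter, mem_preimage]

theorem invariantCore_subset {S : Set Γ} (hS : 1 ∈ S) (U : Set X) : invariantCore S U ⊆ U :=
  fun x hx => one_smul Γ x ▸ hx 1 hS

theorem invariantCore_anti {S T : Set Γ} (h : S ⊆ T) (U : Set X) :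
    invariantCore T U ⊆ invariantCore S U :=
  fun _ hx g hg => hx g (h hg)

theorem invariantCore_mul (S T : Set Γ) (U : Set X) :
    invariantCore (S * T) U = invariantCore T (invariantCore S U) := by
  ext x
  simp only [invariantCore, mem_ofPred_eq, ← image2_mul, forall_mem_image2, mul_smul]
  exact forall₂_comm

theorem smul_invariantCore_univ (g : Γ) (U : Set X) :
    g • invariantCore (univ : Set Γ) U = invariantCore (univ : Set Γ) U := by
  ext x
  simp only [mem_smul_set_iff_inv_smul_mem, invariantCore, mem_ofPred_eq, mem_univ, true_imp_iff,
    smul_smul]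
  exact (Equiv.mulRight g⁻¹).forall_congr_right (q := fun h => h • x ∈ U)

theorem inv_pow_smul_mem_invariantCore {g : Γ} {N : Set ℕ} (hN : IsLowerSet N) {U : Set X}
    (h_inv : ∀ y ∈ invariantCore ((g ^ ·) '' N) U, g⁻¹ • y ∈ U) {x : X}
    (hx : x ∈ invariantCore ((g ^ ·) '' N) U) (j : ℕ) :
    g⁻¹ ^ j • x ∈ invariantCore ((g ^ ·) '' N) U := by
  have h_step : MapsTo (g⁻¹ • ·) (invariantCore ((g ^ ·) '' N) U)
      (invariantCore ((g ^ ·) '' N) U) := by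
    rintro y hy _ ⟨n, hn, rfl⟩
    cases n with
    | zero => simpa only [pow_zero, one_smul] using h_inv y hy
    | succ n =>
      simpa only [pow_succ, mul_smul, smul_inv_smul] using
        hy (g ^ n) (mem_image_of_mem _ (hN n.le_succ hn))
  rw [← smul_iterate_apply]
  exact h_step.iterate j hx

variable [TopologicalSpace X] [ContinuousConstSMul Γ X]

theorem isClosed_invariantCore {U : Set X} (hU : IsClosed U) (S : Set Γ) :
    IsClosed (invariantCore S U) := by
  rw [invariantCore_eq_biInter]
  exact isClosed_biInter fun g _ => hU.preimage (continuous_const_smul g)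

theorem isOpen_invariantCore_of_finite {U : Set X} (hU : IsOpen U) {S : Set Γ} (hS : S.Finite) :
    IsOpen (invariantCore S U) := by
  rw [invariantCore_eq_biInter]
  exact hS.isOpen_biInter fun g _ => hU.preimage (continuous_const_smul g)

theorem IsRecurrentOnCompacts.inv_smul_mem {g : Γ} (hg : IsRecurrentOnCompacts X g) {U : Set X}
    (hU : IsCompact U) (hU_closed : IsClosed U) {x : X} (hx : ∀ n : ℕ, g ^ n • x ∈ U) :
    g⁻¹ • x ∈ U := by
  have h_closed : IsClosed ((g⁻¹ • ·) ⁻¹' U) := hU_closed.preimage (continuous_const_smul g⁻¹)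
  refine closure_minimal ?_ h_closed (hg hU hx)
  rintro _ ⟨n, rfl⟩
  have h_cancel : g⁻¹ • g ^ (n : ℕ) • x = g ^ n.natPred • x := by
    rw [← PNat.natPred_add_one n, pow_succ', mul_smul, inv_smul_smul]
  exact mem_preimage.2 (h_cancel ▸ hx n.natPred)

theorem IsRecurrentOnCompacts.zpow_smul_mem {g : Γ} (hg : IsRecurrentOnCompacts X g) {U : Set X}
    (hU : IsCompact U) (hU_closed : IsClosed U) {x : X} (hx : ∀ n : ℕ, g ^ n • x ∈ U) (k : ℤ) :
    g ^ k • x ∈ U := by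
  obtain ⟨n, rfl | rfl⟩ := k.eq_nat_or_neg
  · simpa only [zpow_natCast] using hx n
  · have h_back : g⁻¹ ^ n • x ∈ invariantCore ((g ^ ·) '' univ) U :=
      inv_pow_smul_mem_invariantCore isLowerSet_univ
        (fun y hy => hg.inv_smul_mem hU hU_closed fun n => hy _ (mem_image_of_mem _ (mem_univ n)))
        (forall_mem_image.2 fun n _ => hx n) n
    simpa only [zpow_neg, zpow_natCast, ← inv_pow] using
      invariantCore_subset (one_mem_image_pow g (mem_univ 0)) U h_back

/-- A set `S` of elements of a group acting on `X` has open cores if the `S`-core of every compact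
clopen set is open. This is the property carried up the polycyclic series. Closedness of `U` is
required separately because `X` need not be Hausdorff. -/
def HasOpenCores (X : Type*) [MulAction Γ X] [TopologicalSpace X] (S : Set Γ) : Prop :=
  ∀ ⦃U : Set X⦄, IsCompact U → IsClopen U → IsOpen (invariantCore S U)

theorem hasOpenCores_of_finite {S : Set Γ} (hS : S.Finite) : HasOpenCores X S :=
  fun _ _ hU => isOpen_invariantCore_of_finite hU.isOpen hS

theorem HasOpenCores.mul {S T : Set Γ} (hS : HasOpenCores X S) (h_one : 1 ∈ S)
    (hT : HasOpenCores X T) : HasOpenCores X (S * T) := by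
  intro U hU hU_clopen
  have h_closed : IsClosed (invariantCore S U) := isClosed_invariantCore hU_clopen.isClosed S
  rw [invariantCore_mul]
  exact hT (hU.of_isClosed_subset h_closed (invariantCore_subset h_one U))
    ⟨h_closed, hS hU hU_clopen⟩

theorem IsRecurrentOnCompacts.exists_forall_inv_smul_mem {g : Γ} (hg : IsRecurrentOnCompacts X g)
    {U : Set X} (hU : IsCompact U) (hU_clopen : IsClopen U) :
    ∃ m : ℕ, ∀ x ∈ invariantCore ((g ^ ·) '' Iic m) U, g⁻¹ • x ∈ U := by
  have h_closed (m : ℕ) : IsClosed (invariantCore ((g ^ ·) '' Iic m) U) :=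
    isClosed_invariantCore hU_clopen.isClosed _
  have h_compact (m : ℕ) : IsCompact (invariantCore ((g ^ ·) '' Iic m) U) :=
    hU.of_isClosed_subset (h_closed m) (invariantCore_subset (one_mem_image_pow g m.zero_le) U)
  have h_anti : Antitone fun m : ℕ => invariantCore ((g ^ ·) '' Iic m) U := fun _ _ hmk =>
    invariantCore_anti (image_mono (Iic_subset_Iic.2 hmk)) U
  have h_inter : ∀ x ∈ ⋂ m : ℕ, invariantCore ((g ^ ·) '' Iic m) U, g⁻¹ • x ∈ U := fun x hx =>
    hg.inv_smul_mem hU hU_clopen.isClosed fun n =>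
      mem_iInter.1 hx n _ (mem_image_of_mem _ (mem_Iic.2 le_rfl))
  have h_open : IsOpen ((g⁻¹ • ·) ⁻¹' U) := hU_clopen.isOpen.preimage (continuous_const_smul g⁻¹)
  exact exists_subset_nhds_of_isCompact' h_anti.directed_ge h_compact h_closed
    fun x hx => h_open.mem_nhds (h_inter x hx)

-- For large `m`, the set cut out by `g ^ n • x ∈ U` for `n ≤ m` is stable under `g⁻¹`, so
-- recurrence of `g⁻¹` makes it the whole core.
theorem IsRecurrentOnCompacts.hasOpenCores_zpowers {g : Γ} (hg : IsRecurrentOnCompacts X g)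
    (hg_inv : IsRecurrentOnCompacts X g⁻¹) :
    HasOpenCores X (Subgroup.zpowers g : Set Γ) := by
  intro U hU hU_clopen
  obtain ⟨m, hm⟩ := hg.exists_forall_inv_smul_mem hU hU_clopen
  have h_eq : invariantCore (Subgroup.zpowers g : Set Γ) U =
      invariantCore ((g ^ ·) '' Iic m) U := by
    refine Subset.antisymm (invariantCore_anti ?_ U) ?_
    · rintro _ ⟨n, -, rfl⟩
      exact Subgroup.npow_mem_zpowers g n
    · rintro x hx _ ⟨k, rfl⟩
      have h_back (j : ℕ) : g⁻¹ ^ j • x ∈ U :=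
        invariantCore_subset (one_mem_image_pow g m.zero_le) U
          (inv_pow_smul_mem_invariantCore (isLowerSet_Iic m) hm hx j)
      simpa only [inv_zpow', neg_neg] using hg_inv.zpow_smul_mem hU hU_clopen.isClosed h_back (-k)
  rw [h_eq]
  exact isOpen_invariantCore_of_finite hU_clopen.isOpen ((finite_Iic m).image _)

theorem IsPolycyclic.hasOpenCores (hΓ : IsPolycyclic Γ)
    (h_rec : ∀ g : Γ, IsRecurrentOnCompacts X g) : HasOpenCores X (univ : Set Γ) := by
  obtain ⟨n, H, h_bot, h_top, h_series⟩ := hΓ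
  suffices h : ∀ i ≤ n, HasOpenCores X (H i : Set Γ) by
    simpa only [h_top, Subgroup.coe_top] using h n le_rfl
  intro i
  induction i with
  | zero =>
    intro _
    rw [h_bot, Subgroup.coe_bot]
    exact hasOpenCores_of_finite (finite_singleton 1)
  | succ i ih =>
    intro hi
    obtain ⟨h_le, h_normal, h_cyclic⟩ := h_series i hi
    obtain ⟨g, hg⟩ := exists_zpowers_mul_coe_eq h_le
    rw [← hg]
    exact ((h_rec g).hasOpenCores_zpowers (h_rec g⁻¹)).mul (one_mem _) (ih (Nat.le_of_succ_le hi))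

instance subgroupContinuousConstSMul (P : Subgroup Γ) : ContinuousConstSMul P X where
  continuous_const_smul p := continuous_const_smul (p : Γ)

theorem HasOpenCores.of_finiteIndex (P : Subgroup Γ) [P.FiniteIndex]
    (hP : HasOpenCores X (univ : Set P)) : HasOpenCores X (univ : Set Γ) := by
  have hP' : HasOpenCores X (P : Set Γ) := fun U hU hU_clopen => by
    have h_eq : invariantCore (P : Set Γ) U = invariantCore (univ : Set P) U := by
      ext x
      simp [invariantCore, Subgroup.smul_def]
    exact h_eq ▸ hP hU hU_clopen
  obtain ⟨T, hT, -⟩ := P.exists_isComplement_right 1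
  rw [← hT.mul_eq]
  exact hP'.mul (one_mem P) (hasOpenCores_of_finite hT.finite_right)

end InvariantCore

section TopologicalAutomorphisms

variable {G : Type*} [Group G] [TopologicalSpace G]

/-- The tautological action of the topological automorphisms of `G` on `G`. -/
instance autMulDistribMulAction : MulDistribMulAction (G ≃ₜ* G) G where
  smul γ x := γ x
  one_smul _ := rfl
  mul_smul _ _ _ := rfl
  smul_mul γ := map_mul γ
  smul_one γ := map_one γ

instance autContinuousConstSMul : ContinuousConstSMul (G ≃ₜ* G) G where
  continuous_const_smul γ := γ.continuous

theorem IsDistalGroup.mono {Γ Δ : Subgroup (G ≃ₜ* G)} (h : IsDistalGroup Γ) (h_le : Δ ≤ Γ) :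
    IsDistalGroup Δ := by
  intro x hx h_mem
  refine h x hx (closure_mono ?_ h_mem)
  rintro _ ⟨γ, hγ, rfl⟩
  exact ⟨γ, h_le hγ, rfl⟩

theorem IsDistalAut.isRecurrentOnCompacts [IsTopologicalGroup G] {α : G ≃ₜ* G}
    (hα : IsDistalAut α) : IsRecurrentOnCompacts G α := by
  refine isRecurrentOnCompacts_of_one_notMem_closure fun z hz h_mem =>
    hα z hz (closure_mono ?_ h_mem)
  rintro _ ⟨n, rfl⟩
  exact ⟨α ^ (n : ℕ), Subgroup.npow_mem_zpowers α n, rfl⟩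

theorem HasOpenCores.isEquicontinuousGroup [IsTopologicalGroup G] [TotallyDisconnectedSpace G]
    [LocallyCompactSpace G] {Γ : Subgroup (G ≃ₜ* G)} (h : HasOpenCores G (univ : Set Γ)) :
    IsEquicontinuousGroup Γ := by
  refine ⟨fun U => ⟨fun hU => ?_, fun ⟨V, hV, hVU⟩ => mem_of_superset hV.1 hVU⟩⟩
  obtain ⟨K, hK, hKU, hK_compact⟩ := local_compact_nhds hU
  obtain ⟨W, hW, h_one, hWK⟩ := loc_compact_Haus_tot_disc_of_zero_dim.mem_nhds_iff.1 hK
  have h_open : IsOpen (invariantCore (univ : Set Γ) W) :=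
    h (hK_compact.of_isClosed_subset hW.isClosed hWK) hW
  have h_one_mem : (1 : G) ∈ invariantCore (univ : Set Γ) W := by
    intro γ _
    simpa only [smul_one] using h_one
  exact ⟨invariantCore (univ : Set Γ) W,
    ⟨h_open.mem_nhds h_one_mem, fun γ hγ => smul_invariantCore_univ (⟨γ, hγ⟩ : Γ) W⟩,
    ((invariantCore_subset (mem_univ 1) W).trans hWK).trans hKU⟩

theorem IsEquicontinuousGroup.isDistalGroup [T1Space G] {Γ : Subgroup (G ≃ₜ* G)}
    (h : IsEquicontinuousGroup Γ) : IsDistalGroup Γ := by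
  intro x hx h_mem
  obtain ⟨V, ⟨hV, h_inv⟩, hVx⟩ := h.mem_iff.1 (isOpen_compl_singleton.mem_nhds hx.symm)
  obtain ⟨_, hγx, γ, hγ, rfl⟩ := mem_closure_iff_nhds.1 h_mem V hV
  rw [← h_inv γ hγ, γ.injective.mem_set_image] at hγx
  exact hVx hγx rfl

end TopologicalAutomorphisms

theorem corollary2p4_general {G : Type*} [Group G] [TopologicalSpace G] [IsTopologicalGroup G]
    [TotallyDisconnectedSpace G] [LocallyCompactSpace G]
    (Γ : Subgroup (G ≃ₜ* G))
    (hΓ : ∃ P : Subgroup Γ, IsPolycyclic P ∧ P.FiniteIndex) :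
    List.TFAE [
      IsDistalGroup Γ,
      ∀ γ ∈ Γ, IsDistalAut γ,
      IsEquicontinuousGroup Γ] := by
  tfae_have 1 → 2 := fun h γ hγ => h.mono (Subgroup.zpowers_le.2 hγ)
  tfae_have 2 → 3 := by
    intro h
    obtain ⟨P, hP, _⟩ := hΓ
    have h_rec (p : P) : IsRecurrentOnCompacts G p := (h p.1 p.1.2).isRecurrentOnCompacts
    exact (HasOpenCores.of_finiteIndex P (hP.hasOpenCores h_rec)).isEquicontinuousGroup
  tfae_have 3 → 1 := IsEquicontinuousGroup.isDistalGroup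
  tfae_finish

theorem corollary2p4 {G : Type*} [Group G] [TopologicalSpace G] [IsTopologicalGroup G]
    [TotallyDisconnectedSpace G] [TopologicalSpace.MetrizableSpace G] [LocallyCompactSpace G]
    (Γ : Subgroup (G ≃ₜ* G))
    (hΓ : ∃ P : Subgroup Γ, IsPolycyclic P ∧ P.FiniteIndex) :
    List.TFAE [
      IsDistalGroup Γ,
      ∀ γ ∈ Γ, IsDistalAut γ,
      IsEquicontinuousGroup Γ] :=
  corollary2p4_general Γ hΓ
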